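/- Let $A$ be a finite group (with the discrete topology), let $\iota$ be a finite set, and let $M$ be the free group or the free monoid on $\iota$. Let $\Gamma$ be the Cayley graph of $M$, in which $m$ is joined to $mg$ for every $m\in M$ and every free generator $g\in\iota$. Equip $A^M$ with the product topology, and let $\mu$ be a Borel probability measure on $A^M$ such that: (i) $\mu$ is stationary, that is, invariant under all shifts $\sigma^e$, $e\in M$, where $(\sigma^e x)_m = x_{em}$; (ii) $\mu$ is a Markov random field on $\Gamma$: whenever $S,U,W\subset M$ are finite and every path in $\Gamma$ from $U$ to $W$ meets $S$, the restrictions $x|_U$ and $x|_W$ of a $\mu$-random configuration $x$ are conditionally independent given $x|_S$; (iii) for every generator $g\in\iota$, all entries of the transition probability matrix $Q_g=\big(\mu(x_g=b\mid x_1=a)\big)_{a,b\in A}$ are defined and nonzero. Then $\mu$ is harmonically mixing: for every $\varepsilon>0$ there is $R>0$ such that every continuous homomorphism $\chi:A^M\to\mathbb{T}$ to the unit circle with $\operatorname{rank}(\chi)>R$ satisfies $\left|\int_{A^M}\chi\,d\mu\right|<\varepsilon$. Here $\operatorname{rank}(\chi)$ is the number of $m\in M$ for which the restriction of $\chi$ to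 the $m$-th factor of $A^M$ is a nontrivial homomorphism $A\to\mathbb{T}$. -/

import Mathlib

open MeasureTheory
open scoped ProbabilityTheory

/-- The shift `σ^e` on the configuration space `A^M`: `(σ^e x)_m = x_{e m}`. -/
def shiftMap {M A : Type*} [Mul M] (e : M) (x : M → A) : M → A :=
  fun m => x (e * m)

/-- A measure on `A^M` is stationary if it is invariant under every shift. -/
def IsShiftStationary {M A : Type*} [Mul M] [MeasurableSpace A] (μ : Measure (M → A)) : Prop :=
  ∀ e : M, MeasurePreserving (shiftMap (A := A) e) μ μ

/-- The cylinder set of all configurations which agree with `x` on the finite set `U`. -/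
def cylinderAt {M A : Type*} (U : Finset M) (x : M → A) : Set (M → A) :=
  {y | ∀ m ∈ U, y m = x m}

/-- `S` separates `U` from `V` in the graph `G`: every walk from `U` to `V` meets `S`. -/
def Separates {V : Type*} (G : SimpleGraph V) (S U W : Finset V) : Prop :=
  ∀ u ∈ U, ∀ w ∈ W, ∀ p : G.Walk u w, ∃ s ∈ S, s ∈ p.support

/-- A measure `μ` on `A^V` (`A` finite) is a Markov random field for the graph `G` on `V`
if, whenever the finite set `S` separates the finite sets `U` and `W`, the restrictions to `U`
and to `W` of a `μ`-random configuration are conditionally independent given its restriction to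
`S`. (If the conditioning event has measure zero, both sides are zero.) -/
def IsMarkovRandomField {V A : Type*} [MeasurableSpace A] (G : SimpleGraph V)
    (μ : Measure (V → A)) : Prop :=
  ∀ S U W : Finset V, Separates G S U W → ∀ x : V → A,
    μ[cylinderAt U x ∩ cylinderAt W x | cylinderAt S x] =
      μ[cylinderAt U x | cylinderAt S x] * μ[cylinderAt W x | cylinderAt S x]

/-- The transition probability matrix of a stationary measure `μ` on `A^M` in the direction of the
generator `g`: its `(a, b)` entry is the conditional probability `P(x_g = b | x_1 = a)`. -/
noncomputable def transitionMatrix {M A : Type*} [One M] [MeasurableSpace A]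
    (μ : Measure (M → A)) (g : M) : Matrix A A ENNReal :=
  Matrix.of fun a b => μ[{x | x g = b} | {x | x 1 = a}]

open Classical in
/-- The rank of a character `χ` of `A^M`: the number of coordinates `m` such that the coefficient
`χ_m : A → 𝕋`, the restriction of `χ` to the `m`-th factor, is nontrivial. -/
noncomputable def characterRank {M A : Type*} [Group A] [TopologicalSpace A]
    (χ : PontryaginDual (M → A)) : ℕ∞ :=
  {m : M | ∃ a : A, χ (Pi.mulSingle m a) ≠ 1}.encard

/-- The Fourier coefficient `⟨μ, χ⟩ = ∫ χ dμ`. -/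
noncomputable def fourierCoefficient {M A : Type*} [Group A] [TopologicalSpace A]
    [MeasurableSpace A] (μ : Measure (M → A)) (χ : PontryaginDual (M → A)) : ℂ :=
  ∫ x, (χ x : ℂ) ∂μ

/-- `μ` is harmonically mixing if its Fourier coefficients tend to zero, uniformly, as the rank of
the character tends to infinity. -/
def IsHarmonicallyMixing {M A : Type*} [Group A] [TopologicalSpace A]
    [MeasurableSpace A] (μ : Measure (M → A)) : Prop :=
  ∀ ε : ℝ, 0 < ε → ∃ R : ℕ, 0 < R ∧ ∀ χ : PontryaginDual (M → A),
    (R : ℕ∞) < characterRank χ → ‖fourierCoefficient μ χ‖ < ε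

/-! A nontrivial coefficient of a character sums to zero over `A`. Near a site `v`, the law of `x_v`
given its neighbours charges every letter by at least some `δ > 0` that does not depend on `v`:
growing the star at `v` edge by edge bounds the probability of each of its configurations from
below, and stationarity leaves only finitely many edge laws. Hence the conditional expectation of
a nontrivial coefficient has modulus at most `c = max (1 - |A| δ) 0 < 1`.

The Cayley graph is a tree, hence bipartite, so at least half of the support of a character is an
independent set `J`. Conditioning the sites of `J` one after the other on their neighbours, which
lie outside `J`, gains a factor `c` each time, and the Fourier coefficient is at most `c ^ |J|`.

In both Cayley graphs every edge `{v, v g}` is a bridge: right multiplication by a generator crosses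
the set of words extending `v g` (in the free group, of `x` with `v⁻¹ x` starting with `g`) only
along this edge.
-/

section Conditioning

variable {Ω α E : Type*} [MeasurableSpace Ω] [NormedAddCommGroup E] [NormedSpace ℝ E]

theorem integral_eq_sum_measureReal_smul_integral_cond [Fintype α] [MeasurableSpace α]
    [DiscreteMeasurableSpace α] {μ : Measure Ω} [IsFiniteMeasure μ] {X : Ω → α}
    (hX : Measurable X) {f : Ω → E} (hf : Integrable f μ) :
    ∫ ω, f ω ∂μ = ∑ a, μ.real (X ⁻¹' {a}) • ∫ ω, f ω ∂μ[|X ⁻¹' {a}] := by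
  conv_lhs => rw [← ProbabilityTheory.sum_meas_smul_cond_fiber hX μ]
  rw [integral_finsetSum_measure fun a _ => ?_]
  · simp only [integral_smul_measure, measureReal_def]
  · by_cases ha : μ (X ⁻¹' {a}) = 0
    · simp [ha]
    · exact (hf.restrict.smul_measure (ENNReal.inv_ne_top.2 ha)).smul_measure (measure_ne_top _ _)

theorem measure_inter_le_cond {μ : Measure Ω} [IsProbabilityMeasure μ] {s : Set Ω}
    (hs : MeasurableSet s) (t : Set Ω) : μ (s ∩ t) ≤ μ[t | s] := by
  rw [← ProbabilityTheory.cond_mul_eq_inter hs]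
  exact mul_le_of_le_one_right' prob_le_one

/-- Doeblin's contraction: subtracting from `ν` the part `δ` times counting measure, on which
`φ` averages to zero, leaves mass `1 - δ * card α`. -/
theorem norm_integral_le_one_sub_of_sum_eq_zero [CompleteSpace E] [Fintype α]
    [MeasurableSpace α] [MeasurableSingletonClass α] {ν : Measure α} [IsProbabilityMeasure ν]
    {δ : ℝ} (hδ : ∀ a, δ ≤ ν.real {a}) {φ : α → E} (hφ : ∀ a, ‖φ a‖ ≤ 1) (hφ0 : ∑ a, φ a = 0) :
    ‖∫ a, φ a ∂ν‖ ≤ 1 - Fintype.card α * δ := by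
  have hsplit : ∫ a, φ a ∂ν = ∑ a, (ν.real {a} - δ) • φ a := by
    rw [integral_fintype Integrable.of_finite]
    simp only [sub_smul, Finset.sum_sub_distrib, ← Finset.smul_sum, hφ0, smul_zero, sub_zero]
  calc ‖∫ a, φ a ∂ν‖ ≤ ∑ a, ‖(ν.real {a} - δ) • φ a‖ := hsplit ▸ norm_sum_le _ _
    _ ≤ ∑ a, (ν.real {a} - δ) := Finset.sum_le_sum fun a _ => by
      rw [norm_smul, Real.norm_of_nonneg (sub_nonneg.2 (hδ a))]
      exact mul_le_of_le_one_right (sub_nonneg.2 (hδ a)) (hφ a)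
    _ = 1 - Fintype.card α * δ := by simp [Finset.sum_sub_distrib]

end Conditioning

section Cylinder

variable {V A : Type*}

theorem cylinderAt_eq_preimage_restrict (U : Finset V) (x : V → A) :
    cylinderAt U x = U.restrict (π := fun _ => A) ⁻¹' {U.restrict x} := by
  ext y
  simp [cylinderAt, funext_iff]

theorem dependsOn_cylinderAt (U : Finset V) : DependsOn (cylinderAt (A := A) U) U := fun x y h => by
  ext z
  exact forall₂_congr fun m hm => by rw [h m hm]

theorem cylinderAt_singleton_update [DecidableEq V] (v : V) (x : V → A) (a : A) :
    cylinderAt {v} (Function.update x v a) = Function.eval v ⁻¹' ({a} : Set A) := by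
  ext y
  simp [cylinderAt]

theorem cylinderAt_insert [DecidableEq V] (v : V) (U : Finset V) (x : V → A) :
    cylinderAt (insert v U) x = cylinderAt U x ∩ cylinderAt {v} x := by
  ext y
  simp [cylinderAt, and_comm]

theorem cylinderAt_anti {U W : Finset V} (h : U ⊆ W) (x : V → A) :
    cylinderAt W x ⊆ cylinderAt U x := fun _ hy m hm => hy m (h hm)

theorem cylinderAt_update_of_notMem [DecidableEq V] {v : V} {U : Finset V} (hv : v ∉ U)
    (x : V → A) (a : A) : cylinderAt U (Function.update x v a) = cylinderAt U x :=
  dependsOn_cylinderAt U fun _ hm => Function.update_of_ne (ne_of_mem_of_not_mem hm hv) _ _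

variable [MeasurableSpace A] [MeasurableSingletonClass A]

theorem measurableSet_cylinderAt (U : Finset V) (x : V → A) : MeasurableSet (cylinderAt U x) := by
  rw [cylinderAt_eq_preimage_restrict]
  exact U.measurable_restrict (measurableSet_singleton _)

theorem measurableSet_setOf_apply_eq (v : V) (a : A) : MeasurableSet {x : V → A | x v = a} := by
  simpa [cylinderAt] using measurableSet_cylinderAt {v} fun _ => a

theorem integral_mul_cond_cylinderAt {μ : Measure (V → A)} {W : Finset V}
    {f g : (V → A) → ℂ} (hg : DependsOn g (W : Set V)) (x : V → A) :
    ∫ y, f y * g y ∂μ[|cylinderAt W x] = (∫ y, f y ∂μ[|cylinderAt W x]) * g x := by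
  rw [← integral_mul_const]
  refine integral_congr_ae ?_
  filter_upwards [ProbabilityTheory.ae_cond_mem (measurableSet_cylinderAt W x)] with y hy
  rw [hg hy]

variable [Finite A] {E : Type*} [NormedAddCommGroup E] {μ : Measure (V → A)} [IsFiniteMeasure μ]
  {W : Finset V}

theorem integrable_of_dependsOn {f : (V → A) → E} (hf : DependsOn f (W : Set V)) :
    Integrable f μ := by
  obtain ⟨g, rfl⟩ := dependsOn_iff_exists_comp.1 hf
  exact Integrable.of_finite.comp_measurable
    (measurable_pi_lambda _ fun m => measurable_pi_apply m.1)

theorem integral_eq_of_integral_cond_cylinderAt_eq [NormedSpace ℝ E] {f g : (V → A) → E}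
    (hf : Integrable f μ) (hg : Integrable g μ)
    (h : ∀ x, μ (cylinderAt W x) ≠ 0 →
      ∫ y, f y ∂μ[|cylinderAt W x] = ∫ y, g y ∂μ[|cylinderAt W x]) :
    ∫ x, f x ∂μ = ∫ x, g x ∂μ := by
  have := Fintype.ofFinite (W → A)
  have hW : Measurable (W.restrict (π := fun _ => A)) := W.measurable_restrict
  rw [integral_eq_sum_measureReal_smul_integral_cond hW hf,
    integral_eq_sum_measureReal_smul_integral_cond hW hg]
  refine Finset.sum_congr rfl fun p _ => ?_
  by_cases hp : μ (W.restrict (π := fun _ => A) ⁻¹' {p}) = 0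
  · simp [measureReal_def, hp]
  · obtain ⟨x, rfl⟩ := nonempty_of_measure_ne_zero hp
    rw [← cylinderAt_eq_preimage_restrict] at hp ⊢
    rw [h x hp]

end Cylinder

section Graph

variable {V : Type*} {G : SimpleGraph V}

theorem separates_neighborFinset_singleton {v : V} [Fintype (G.neighborSet v)] {W : Finset V}
    (hv : v ∉ W) : Separates G (G.neighborFinset v) {v} W := by
  rintro u hu w hw p
  obtain rfl := Finset.mem_singleton.1 hu
  cases p with
  | nil => exact absurd hw hv
  | cons h p => exact ⟨_, (G.mem_neighborFinset _ _).2 h, by simp⟩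

theorem mem_support_of_adj_of_adj (hG : G.IsAcyclic) {u v w : V} (hu : G.Adj u v)
    (hw : G.Adj v w) (huw : u ≠ w) (p : G.Walk u w) : v ∈ p.support := by
  classical
  have hpath : (SimpleGraph.Walk.cons hu (.cons hw .nil)).IsPath := by
    simp [hu.ne, hw.ne, huw]
  have : p.bypass = .cons hu (.cons hw .nil) :=
    congrArg Subtype.val <|
      (hG.subsingleton_path u w).elim ⟨_, p.bypass_isPath⟩ ⟨_, hpath⟩
  exact p.support_bypass_subset_support (by simp [this])

theorem separates_singleton_of_adj (hG : G.IsAcyclic) {u v : V} (huv : G.Adj v u) {N : Finset V}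
    (hN : ∀ w ∈ N, G.Adj v w) (hu : u ∉ N) [DecidableEq V] :
    Separates G {v} {u} (insert v N) := by
  rintro u' hu' w hw p
  obtain rfl := Finset.mem_singleton.1 hu'
  refine ⟨v, Finset.mem_singleton_self v, ?_⟩
  obtain rfl | hwN := Finset.mem_insert.1 hw
  · exact p.end_mem_support
  · exact mem_support_of_adj_of_adj hG huv.symm (hN w hwN) (ne_of_mem_of_not_mem hwN hu).symm p

theorem isBridge_of_forall_adj_mem_iff {u v : V} {s : Set V} (hu : u ∉ s) (hv : v ∈ s)
    (hs : ∀ x y, G.Adj x y → s(x, y) ≠ s(u, v) → (x ∈ s ↔ y ∈ s)) : G.IsBridge s(u, v) := by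
  rw [SimpleGraph.isBridge_iff]
  rintro ⟨p⟩
  have hp {x y : V} (p : (G.deleteEdges {s(u, v)}).Walk x y) : x ∈ s ↔ y ∈ s := by
    induction p with
    | nil => rfl
    | cons h _ ih =>
      obtain ⟨hadj, hne⟩ := SimpleGraph.deleteEdges_adj.1 h
      exact (hs _ _ hadj hne).trans ih
  exact hu ((hp p).2 hv)

theorem exists_isIndepSet_subset_of_colorable {k n : ℕ} (hG : G.Colorable k) (hk : k ≠ 0)
    {S : Finset V} (hS : k * n ≤ S.card) :
    ∃ J ⊆ S, G.IsIndepSet (J : Set V) ∧ n ≤ J.card := by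
  classical
  obtain ⟨C⟩ := hG
  have : NeZero k := ⟨hk⟩
  obtain ⟨i, -, hi⟩ := Finset.exists_le_card_fiber_of_mul_le_card_of_maps_to
    (s := S) (t := Finset.univ) (f := C) (n := n) (fun _ _ => Finset.mem_univ _)
    Finset.univ_nonempty (by simpa using hS)
  refine ⟨_, Finset.filter_subset _ _, fun u hu v hv _ huv => C.valid huv ?_, hi⟩
  simp only [Finset.coe_filter, Set.mem_ofPred_eq] at hu hv
  rw [hu.2, hv.2]

end Graph

namespace IsMarkovRandomField

variable {V A : Type*} [MeasurableSpace A] [MeasurableSingletonClass A] {G : SimpleGraph V}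
  {μ : Measure (V → A)} {v : V} {S W : Finset V}

theorem cond_cylinderAt_eq [IsFiniteMeasure μ] (hμ : IsMarkovRandomField G μ) {U : Finset V}
    (hS : Separates G S U W) (hSW : S ⊆ W) {x : V → A} (hx : μ (cylinderAt W x) ≠ 0) :
    μ[cylinderAt U x | cylinderAt W x] = μ[cylinderAt U x | cylinderAt S x] := by
  have hmS := measurableSet_cylinderAt S x
  have hmW := measurableSet_cylinderAt W x
  have hSWx : cylinderAt S x ∩ cylinderAt W x = cylinderAt W x :=
    Set.inter_eq_right.2 (cylinderAt_anti hSW x)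
  have hpos : μ[cylinderAt W x | cylinderAt S x] ≠ 0 :=
    (ProbabilityTheory.cond_pos_of_inter_ne_zero hmS (hSWx.symm ▸ hx)).ne'
  calc μ[cylinderAt U x | cylinderAt W x]
      = μ[|cylinderAt S x][cylinderAt U x | cylinderAt W x] := by
        rw [ProbabilityTheory.cond_cond_eq_cond_inter hmS hmW, hSWx]
    _ = (μ[cylinderAt W x | cylinderAt S x])⁻¹ *
          (μ[cylinderAt U x | cylinderAt S x] * μ[cylinderAt W x | cylinderAt S x]) := by
        rw [ProbabilityTheory.cond_apply hmW, Set.inter_comm, hμ S U W hS x]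
    _ = μ[cylinderAt U x | cylinderAt S x] := by
        rw [mul_comm (μ[cylinderAt U x | cylinderAt S x]),
          ENNReal.inv_mul_cancel_left hpos (measure_ne_top _ _)]

/-- Grow the star at `v` one neighbour at a time: given the value at `v`, each new neighbour is
independent of the previous ones. -/
theorem pow_le_measure_cylinderAt_insert [IsProbabilityMeasure μ] [DecidableEq V]
    (hμ : IsMarkovRandomField G μ) (hG : G.IsAcyclic) {q : ENNReal} (hq0 : q ≠ 0) {x : V → A}
    (hq : q ≤ μ (cylinderAt {v} x)) (hqe : ∀ u, G.Adj v u → q ≤ μ (cylinderAt {v, u} x))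
    {N : Finset V} (hN : ∀ u ∈ N, G.Adj v u) :
    q ^ (N.card + 1) ≤ μ (cylinderAt (insert v N) x) := by
  induction N using Finset.induction_on with
  | empty => simpa using hq
  | insert u N hu ih =>
    have hvu : G.Adj v u := hN u (Finset.mem_insert_self u N)
    have hNv : ∀ w ∈ N, G.Adj v w := fun w hw => hN w (Finset.mem_insert_of_mem hw)
    have hpos : μ (cylinderAt (insert v N) x) ≠ 0 :=
      ((pow_ne_zero _ hq0).bot_lt.trans_le (ih hNv)).ne'
    have hcond : q ≤ μ[cylinderAt {u} x | cylinderAt {v} x] := by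
      refine (hqe u hvu).trans ?_
      rw [Finset.pair_comm, cylinderAt_insert]
      exact measure_inter_le_cond (measurableSet_cylinderAt _ _) _
    calc q ^ ((insert u N).card + 1)
        = q * q ^ (N.card + 1) := by rw [Finset.card_insert_of_notMem hu]; ring
      _ ≤ μ[cylinderAt {u} x | cylinderAt (insert v N) x] * μ (cylinderAt (insert v N) x) := by
        gcongr
        · rwa [hμ.cond_cylinderAt_eq (separates_singleton_of_adj hG hvu hNv hu) (by simp) hpos]
        · exact ih hNv
      _ = μ (cylinderAt (insert v (insert u N)) x) := by
        rw [ProbabilityTheory.cond_mul_eq_inter (measurableSet_cylinderAt _ _),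
          Finset.insert_comm v, cylinderAt_insert u]

theorem pow_le_cond_cylinderAt_neighborFinset [IsProbabilityMeasure μ] [DecidableEq V]
    [Fintype (G.neighborSet v)] (hμ : IsMarkovRandomField G μ) (hG : G.IsAcyclic) {q : ENNReal}
    (hq0 : q ≠ 0) {x : V → A} (hq : q ≤ μ (cylinderAt {v} x))
    (hqe : ∀ u, G.Adj v u → q ≤ μ (cylinderAt {v, u} x)) :
    q ^ (G.degree v + 1) ≤ μ[cylinderAt {v} x | cylinderAt (G.neighborFinset v) x] :=
  calc q ^ (G.degree v + 1)
      ≤ μ (cylinderAt (insert v (G.neighborFinset v)) x) :=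
        hμ.pow_le_measure_cylinderAt_insert hG hq0 hq hqe fun u => (G.mem_neighborFinset v u).1
    _ = μ (cylinderAt (G.neighborFinset v) x ∩ cylinderAt {v} x) := by rw [cylinderAt_insert]
    _ ≤ μ[cylinderAt {v} x | cylinderAt (G.neighborFinset v) x] :=
        measure_inter_le_cond (measurableSet_cylinderAt _ _) _

theorem norm_integral_cond_neighborFinset_le [DecidableEq V] [Fintype A] [IsProbabilityMeasure μ]
    [Fintype (G.neighborSet v)] (hμ : IsMarkovRandomField G μ) (hG : G.IsAcyclic) {q : NNReal}
    (hq0 : q ≠ 0) (hq : ∀ x, q ≤ μ (cylinderAt {v} x))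
    (hqe : ∀ u, G.Adj v u → ∀ x, q ≤ μ (cylinderAt {v, u} x))
    {φ : A → ℂ} (hφ : ∀ a, ‖φ a‖ ≤ 1) (hφ0 : ∑ a, φ a = 0) (x : V → A) :
    ‖∫ y, φ (y v) ∂μ[|cylinderAt (G.neighborFinset v) x]‖ ≤
      1 - Fintype.card A * (q : ℝ) ^ (G.degree v + 1) := by
  have hlaw (a : A) : (q : ENNReal) ^ (G.degree v + 1) ≤
      μ[Function.eval v ⁻¹' {a} | cylinderAt (G.neighborFinset v) x] := by
    rw [← cylinderAt_singleton_update v x a,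
      ← cylinderAt_update_of_notMem (G.notMem_neighborFinset_self v) x a]
    exact hμ.pow_le_cond_cylinderAt_neighborFinset hG (by simpa) (hq _) fun u hu => hqe u hu _
  have hpos : μ (cylinderAt (G.neighborFinset v) x) ≠ 0 := fun h0 => by
    simpa [ProbabilityTheory.cond_eq_zero_of_meas_eq_zero h0, hq0] using hlaw (x v)
  have := ProbabilityTheory.cond_isProbabilityMeasure hpos
  have hv : Measurable (Function.eval v : (V → A) → A) := measurable_pi_apply v
  have := Measure.isProbabilityMeasure_map (hv.aemeasurable
    (μ := μ[|cylinderAt (G.neighborFinset v) x]))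
  rw [← integral_map hv.aemeasurable (measurable_of_finite φ).aestronglyMeasurable (f := φ)]
  refine norm_integral_le_one_sub_of_sum_eq_zero (fun a => ?_) hφ hφ0
  rw [measureReal_def, Measure.map_apply hv (measurableSet_singleton a)]
  simpa using ENNReal.toReal_mono (measure_ne_top _ _) (hlaw a)

variable [Finite A]

theorem map_eval_cond_cylinderAt_eq [IsFiniteMeasure μ] (hμ : IsMarkovRandomField G μ)
    (hS : Separates G S {v} W) (hSW : S ⊆ W) (hv : v ∉ W) {x : V → A}
    (hx : μ (cylinderAt W x) ≠ 0) :
    (μ[|cylinderAt W x]).map (Function.eval v) = (μ[|cylinderAt S x]).map (Function.eval v) := by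
  classical
  refine Measure.ext_of_singleton fun a => ?_
  rw [← cylinderAt_update_of_notMem hv x a] at hx
  have := hμ.cond_cylinderAt_eq hS hSW hx
  rwa [cylinderAt_singleton_update, cylinderAt_update_of_notMem hv,
    cylinderAt_update_of_notMem (hv <| hSW ·),
    ← Measure.map_apply (measurable_pi_apply v) (measurableSet_singleton a),
    ← Measure.map_apply (measurable_pi_apply v) (measurableSet_singleton a)] at this

theorem integral_apply_mul_eq [IsFiniteMeasure μ] (hμ : IsMarkovRandomField G μ)
    (hS : Separates G S {v} W) (hSW : S ⊆ W) (hv : v ∉ W) (φ : A → ℂ) {g : (V → A) → ℂ}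
    (hg : DependsOn g (W : Set V)) :
    ∫ x, φ (x v) * g x ∂μ = ∫ x, (∫ y, φ (y v) ∂μ[|cylinderAt S x]) * g x ∂μ := by
  classical
  have hexp : DependsOn (fun x => (∫ y, φ (y v) ∂μ[|cylinderAt S x]) * g x) (W : Set V) :=
    fun x y h => by
      simp only [hg h, dependsOn_cylinderAt S fun m hm => h m (hSW hm)]
  have hφg : DependsOn (fun x => φ (x v) * g x) (insert v W : Finset V) := fun x y h => by
    simp only [h v (Finset.mem_insert_self v W), hg fun m hm => h m (Finset.mem_insert_of_mem hm)]
  refine integral_eq_of_integral_cond_cylinderAt_eq (W := W) (integrable_of_dependsOn hφg)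
    (integrable_of_dependsOn hexp) fun x hx => ?_
  have := ProbabilityTheory.cond_isProbabilityMeasure hx
  have hlaw : ∫ y, φ (y v) ∂μ[|cylinderAt W x] = ∫ y, φ (y v) ∂μ[|cylinderAt S x] := by
    have hφ (ν : Measure (V → A)) : ∫ y, φ (y v) ∂ν = ∫ a, φ a ∂ν.map (Function.eval v) :=
      (integral_map (measurable_pi_apply v).aemeasurable
        (measurable_of_finite φ).aestronglyMeasurable).symm
    rw [hφ, hφ, hμ.map_eval_cond_cylinderAt_eq hS hSW hv hx]
  calc ∫ y, φ (y v) * g y ∂μ[|cylinderAt W x]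
      = (∫ y, φ (y v) ∂μ[|cylinderAt S x]) * g x := by
        rw [integral_mul_cond_cylinderAt hg, hlaw]
    _ = ∫ y, (∫ z, φ (z v) ∂μ[|cylinderAt S y]) * g y ∂μ[|cylinderAt W x] := by
        simpa using (integral_mul_cond_cylinderAt (μ := μ) (f := fun _ => 1) hexp x).symm

theorem integral_prod_insert_mul_eq [IsFiniteMeasure μ] [DecidableEq V] [Fintype (G.neighborSet v)]
    (hμ : IsMarkovRandomField G μ) (φ : V → A → ℂ) {J T : Finset V} (hvJ : v ∉ J) (hvT : v ∉ T)
    {g : (V → A) → ℂ} (hg : DependsOn g (T : Set V)) :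
    ∫ x, (∏ u ∈ insert v J, φ u (x u)) * g x ∂μ =
      ∫ x, (∏ u ∈ J, φ u (x u)) *
        ((∫ y, φ v (y v) ∂μ[|cylinderAt (G.neighborFinset v) x]) * g x) ∂μ := by
  let W := G.neighborFinset v ∪ J ∪ T
  have hvW : v ∉ W := by simp [W, hvJ, hvT]
  have hrest : DependsOn (fun x => (∏ u ∈ J, φ u (x u)) * g x) (W : Set V) := fun x y h => by
    simp only [hg fun m hm => h m (Finset.mem_union_right _ hm)]
    congr 1
    refine Finset.prod_congr rfl fun u hu => ?_
    rw [h u (Finset.mem_union_left _ (Finset.mem_union_right _ hu))]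
  simp only [Finset.prod_insert hvJ, mul_assoc, mul_left_comm _ (∫ _, _ ∂_) _]
  exact hμ.integral_apply_mul_eq (separates_neighborFinset_singleton hvW)
    (Finset.subset_union_left.trans Finset.subset_union_left) hvW (φ v) hrest

/-- Conditioning on its neighbours replaces a factor `φ v` by a function of those neighbours, which
can be absorbed into `g` because the remaining sites of `J` are not among them. -/
theorem norm_integral_prod_mul_le [IsProbabilityMeasure μ] [G.LocallyFinite]
    (hμ : IsMarkovRandomField G μ) {φ : V → A → ℂ} {c : ℝ} {J : Finset V}
    (hJ : G.IsIndepSet (J : Set V))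
    (hc : ∀ v ∈ J, ∀ x, ‖∫ y, φ v (y v) ∂μ[|cylinderAt (G.neighborFinset v) x]‖ ≤ c)
    {T : Finset V} (hJT : Disjoint J T) {g : (V → A) → ℂ} (hg : DependsOn g (T : Set V))
    {C : ℝ} (hC : ∀ x, ‖g x‖ ≤ C) :
    ‖∫ x, (∏ v ∈ J, φ v (x v)) * g x ∂μ‖ ≤ c ^ J.card * C := by
  classical
  induction J using Finset.induction_on generalizing T g C with
  | empty => simpa using norm_integral_le_of_norm_le_const (μ := μ) (Filter.Eventually.of_forall hC)
  | insert v J hvJ ih =>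
    rw [Finset.coe_insert] at hJ
    obtain ⟨hvT, hJT⟩ := Finset.disjoint_insert_left.1 hJT
    have hJN : Disjoint J (G.neighborFinset v) := Finset.disjoint_left.2 fun u hu huN =>
      hJ (Set.mem_insert v _) (Set.mem_insert_of_mem v hu) (ne_of_mem_of_not_mem hu hvJ).symm
        ((G.mem_neighborFinset v u).1 huN)
    have hg' : DependsOn (fun x => (∫ y, φ v (y v) ∂μ[|cylinderAt (G.neighborFinset v) x]) * g x)
        (G.neighborFinset v ∪ T : Finset V) := fun x y h => by
      simp only [hg fun m hm => h m (Finset.mem_union_right _ hm),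
        dependsOn_cylinderAt _ fun m hm => h m (Finset.mem_union_left T hm)]
    calc ‖∫ x, (∏ u ∈ insert v J, φ u (x u)) * g x ∂μ‖
        ≤ c ^ J.card * (c * C) := by
          rw [hμ.integral_prod_insert_mul_eq φ hvJ hvT hg]
          exact ih (hJ.mono (Set.subset_insert v _))
            (fun u hu => hc u (Finset.mem_insert_of_mem hu))
            (Finset.disjoint_union_right.2 ⟨hJN, hJT⟩) hg'
            fun x => norm_mul_le_of_le (hc v (Finset.mem_insert_self v J) x) (hC x)
      _ = c ^ (insert v J).card * C := by rw [Finset.card_insert_of_notMem hvJ]; ring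

end IsMarkovRandomField

section Character

variable {M A : Type*} [DecidableEq M] [Group A]

theorem map_piecewise_one {N : Type*} [CommMonoid N] (f : (M → A) →* N) (T : Finset M)
    (x : M → A) : f (T.piecewise x 1) = ∏ m ∈ T, f (Pi.mulSingle m (x m)) := by
  induction T using Finset.induction_on with
  | empty => simp
  | insert m T hm ih =>
    have hsplit : (insert m T).piecewise x 1 = Pi.mulSingle m (x m) * T.piecewise x 1 := by
      ext k
      obtain rfl | hk := eq_or_ne k m
      · simp [hm]
      · by_cases hkT : k ∈ T <;> simp [hk, hkT]
    rw [hsplit, map_mul, ih, Finset.prod_insert hm]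

variable [TopologicalSpace A]

/-- The coefficient `χ_m : A → 𝕋` of a character `χ` of `A^M`: its restriction to the `m`-th factor,
regarded as complex valued. -/
noncomputable def characterCoefficient (χ : PontryaginDual (M → A)) (m : M) : A →* ℂ :=
  Circle.coeHom.comp (χ.toMonoidHom.comp (MonoidHom.mulSingle (fun _ => A) m))

theorem characterCoefficient_apply (χ : PontryaginDual (M → A)) (m : M) (a : A) :
    characterCoefficient χ m a = χ (Pi.mulSingle m a) := rfl

theorem norm_characterCoefficient (χ : PontryaginDual (M → A)) (m : M) (a : A) :
    ‖characterCoefficient χ m a‖ = 1 := Circle.norm_coe _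

theorem characterRank_eq_encard (χ : PontryaginDual (M → A)) :
    characterRank χ = {m | characterCoefficient χ m ≠ 1}.encard := by
  simp only [characterRank, ne_eq, MonoidHom.ext_iff, not_forall, characterCoefficient_apply,
    MonoidHom.one_apply, Circle.coe_eq_one]
  congr!

/-- The values of `χ` are among the finitely many `|A|`-th roots of unity, so its kernel is open. -/
theorem exists_finset_forall_apply_eq_one {M A : Type*} [Group A] [TopologicalSpace A]
    [Finite A] (χ : PontryaginDual (M → A)) :
    ∃ F : Finset M, ∀ x : M → A, (∀ m ∈ F, x m = 1) → χ x = 1 := by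
  have hfin : (Set.range χ).Finite := by
    refine ((Polynomial.nthRootsFinset (Nat.card A) (1 : ℂ)).finite_toSet.preimage
      Circle.coe_injective.injOn).subset ?_
    rintro _ ⟨x, rfl⟩
    have hx : χ x ^ Nat.card A = 1 := by
      rw [← map_pow, show x ^ Nat.card A = 1 from funext fun m => pow_card_eq_one', map_one]
    exact (Polynomial.mem_nthRootsFinset Nat.card_pos _).2 (by exact_mod_cast congrArg _ hx)
  have hopen : IsOpen (χ ⁻¹' (Set.range χ \ {1})ᶜ) :=
    (hfin.subset Set.sdiff_subset).isClosed.isOpen_compl.preimage (map_continuous χ)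
  obtain ⟨F, U, hU, hF⟩ := isOpen_pi_iff.1 hopen 1 (by simp)
  refine ⟨F, fun x hx => ?_⟩
  simpa using hF fun m hm => (hx m hm).symm ▸ (hU m hm).2

theorem exists_finset_eq_prod_characterCoefficient [Finite A] (χ : PontryaginDual (M → A)) :
    ∃ S : Finset M, characterRank χ = S.card ∧ (∀ m ∈ S, characterCoefficient χ m ≠ 1) ∧
      ∀ x, (χ x : ℂ) = ∏ m ∈ S, characterCoefficient χ m (x m) := by
  classical
  obtain ⟨F, hF⟩ := exists_finset_forall_apply_eq_one χ
  have hprod (x : M → A) : (χ x : ℂ) = ∏ m ∈ F, characterCoefficient χ m (x m) := by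
    have hx : χ x = χ (F.piecewise x 1) := by
      rw [← div_eq_one, ← map_div]
      exact hF _ fun m hm => by simp [hm]
    rw [hx]
    exact map_piecewise_one (Circle.coeHom.comp χ.toMonoidHom) F x
  have htrivial : ∀ m ∉ F, characterCoefficient χ m = 1 := fun m hm => by
    ext a
    have : χ (Pi.mulSingle m a) = 1 := hF _ fun k hk =>
      Pi.mulSingle_eq_of_ne (M := fun _ => A) (ne_of_mem_of_not_mem hk hm) a
    simp [characterCoefficient_apply, this]
  refine ⟨F.filter (characterCoefficient χ · ≠ 1), ?_, by simp, fun x => ?_⟩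
  · rw [characterRank_eq_encard, ← Set.encard_coe_eq_coe_finsetCard]
    congr 1
    ext m
    simpa using not_imp_comm.1 (htrivial m)
  · rw [hprod, Finset.prod_filter_of_ne]
    rintro m - hm h1
    simp [h1] at hm

end Character

theorem IsMarkovRandomField.isHarmonicallyMixing_of_isAcyclic {V A : Type*} [Group A] [Finite A]
    [TopologicalSpace A] [MeasurableSpace A] [MeasurableSingletonClass A] [DecidableEq V]
    {G : SimpleGraph V} [G.LocallyFinite] {μ : Measure (V → A)} [IsProbabilityMeasure μ]
    (hμ : IsMarkovRandomField G μ) (hG : G.IsAcyclic) {D : ℕ} (hD : ∀ v, G.degree v ≤ D)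
    {q : NNReal} (hq0 : q ≠ 0) (hq : ∀ v x, q ≤ μ (cylinderAt {v} x))
    (hqe : ∀ v u, G.Adj v u → ∀ x, q ≤ μ (cylinderAt {v, u} x)) : IsHarmonicallyMixing μ := by
  intro ε hε
  have := Fintype.ofFinite A
  let c : ℝ := max (1 - Fintype.card A * (q : ℝ) ^ (D + 1)) 0
  have hc1 : c < 1 := max_lt (sub_lt_self _ (by positivity)) one_pos
  have hsite (χ : PontryaginDual (V → A)) (v : V) (hv : characterCoefficient χ v ≠ 1) (x : V → A) :
      ‖∫ y, characterCoefficient χ v (y v) ∂μ[|cylinderAt (G.neighborFinset v) x]‖ ≤ c := by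
    have hq1 : (q : ℝ) ≤ 1 := by exact_mod_cast (hq v x).trans prob_le_one
    refine (hμ.norm_integral_cond_neighborFinset_le hG hq0 (hq v) (hqe v)
      (fun a => (norm_characterCoefficient χ v a).le) ?_ x).trans (le_max_of_le_left ?_)
    · exact sum_hom_units_eq_zero _ hv
    · gcongr ?_ - _ * ?_
      exact pow_le_pow_of_le_one q.2 hq1 (Nat.succ_le_succ (hD v))
  obtain ⟨n, hn⟩ := exists_pow_lt_of_lt_one hε hc1
  refine ⟨2 * n + 1, Nat.succ_pos _, fun χ hχ => ?_⟩
  obtain ⟨S, hScard, hS, hχS⟩ := exists_finset_eq_prod_characterCoefficient χ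
  have hSn : 2 * n ≤ S.card := by rw [hScard] at hχ; norm_cast at hχ; omega
  obtain ⟨J, hJS, hJ, hJn⟩ := exists_isIndepSet_subset_of_colorable hG.colorable_two two_ne_zero hSn
  let g : (V → A) → ℂ := fun x => ∏ m ∈ S \ J, characterCoefficient χ m (x m)
  have hg : DependsOn g (S \ J : Finset V) := fun x y h =>
    Finset.prod_congr rfl fun m hm => by rw [h m hm]
  have hg1 (x : V → A) : ‖g x‖ ≤ 1 := by simp [g, norm_characterCoefficient]
  calc ‖fourierCoefficient μ χ‖
      = ‖∫ x, (∏ m ∈ J, characterCoefficient χ m (x m)) * g x ∂μ‖ := by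
        simp only [fourierCoefficient, hχS, g, ← Finset.prod_sdiff hJS, mul_comm]
    _ ≤ c ^ J.card * 1 := hμ.norm_integral_prod_mul_le hJ (fun v hv => hsite χ v (hS v (hJS hv)))
        Finset.disjoint_sdiff hg hg1
    _ ≤ c ^ n := by
      rw [mul_one]
      exact pow_le_pow_of_le_one (le_max_right _ _) hc1.le hJn
    _ < ε := hn

section CayleyGraph

open SimpleGraph (mulCayley)

variable {M ι : Type*} {γ : ι → M}

theorem mulCayley_range_adj [Mul M] {u v : M} :
    (mulCayley (Set.range γ)).Adj u v ↔ u ≠ v ∧ ∃ i, u * γ i = v ∨ v * γ i = u := by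
  simp [SimpleGraph.mulCayley_adj', eq_comm]

theorem exists_injective_neighborSet_mulCayley_range [Mul M] [IsRightCancelMul M] (γ : ι → M)
    (v : M) :
    ∃ f : (mulCayley (Set.range γ)).neighborSet v → ι ⊕ ι, Function.Injective f := by
  have h (u : (mulCayley (Set.range γ)).neighborSet v) :
      ∃ j : ι ⊕ ι, Sum.elim (fun i => v * γ i = u) (fun i => u * γ i = v) j := by
    obtain ⟨i, hi | hi⟩ := (mulCayley_range_adj.1 u.2).2
    exacts [⟨.inl i, hi⟩, ⟨.inr i, hi⟩]
  choose f hf using h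
  refine ⟨f, fun u w huw => Subtype.ext ?_⟩
  have hu := hf u
  have hw := hf w
  rw [← huw] at hw
  cases hfu : f u with
  | inl i =>
    simp only [hfu, Sum.elim_inl] at hu hw
    exact hu.symm.trans hw
  | inr i =>
    simp only [hfu, Sum.elim_inr] at hu hw
    exact mul_right_cancel (hu.trans hw.symm)

theorem isAcyclic_mulCayley_range [Mul M] (s : M → ι → Set M) (hv : ∀ v i, v ∉ s v i)
    (hvi : ∀ v i, v * γ i ∈ s v i)
    (hs : ∀ v i x j, (x, j) ≠ (v, i) → (x * γ j ∈ s v i ↔ x ∈ s v i)) :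
    (mulCayley (Set.range γ)).IsAcyclic := by
  have hbridge (v : M) (i : ι) : (mulCayley (Set.range γ)).IsBridge s(v, v * γ i) := by
    refine isBridge_of_forall_adj_mem_iff (hv v i) (hvi v i) fun x y hxy hne => ?_
    obtain ⟨j, rfl | rfl⟩ := (mulCayley_range_adj.1 hxy).2
    · exact (hs v i x j fun h => hne (by cases h; rfl)).symm
    · exact hs v i y j fun h => hne (by cases h; exact Sym2.eq_swap)
  refine SimpleGraph.isAcyclic_iff_forall_adj_isBridge.2 fun u v huv => ?_
  obtain ⟨i, rfl | rfl⟩ := (mulCayley_range_adj.1 huv).2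
  · exact hbridge u i
  · exact Sym2.eq_swap (a := v) ▸ hbridge v i

theorem reachable_mul_generator_mulCayley_range [Mul M] (v : M) (i : ι) :
    (mulCayley (Set.range γ)).Reachable v (v * γ i) := by
  by_cases h : v = v * γ i
  · rw [← h]
  · exact (mulCayley_range_adj.2 ⟨h, i, .inl rfl⟩).reachable

theorem preconnected_of_forall_reachable_mul [MulOneClass M] {G : SimpleGraph M}
    (h : ∀ x v : M, G.Reachable v (v * x)) : G.Preconnected := fun u v => by
  have h1 (x : M) : G.Reachable 1 x := by simpa using h x 1
  exact (h1 u).symm.trans (h1 v)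

theorem isTree_mulCayley_freeMonoid (ι : Type*) :
    (mulCayley (Set.range (FreeMonoid.of (α := ι)))).IsTree where
  connected := ⟨preconnected_of_forall_reachable_mul fun x => by
    induction x using FreeMonoid.inductionOn with
    | one => simp
    | of i => exact fun v => reachable_mul_generator_mulCayley_range v i
    | mul x y hx hy => exact fun v => mul_assoc v x y ▸ (hx v).trans (hy (v * x))⟩
  isAcyclic := by
    refine isAcyclic_mulCayley_range (fun v i => {x | (v * .of i).toList <+: x.toList})
      (fun v i h => ?_) (fun v i => List.prefix_rfl) fun v i x j hne => ?_
    · simpa using h.length_le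
    · rw [Set.mem_ofPred_eq, FreeMonoid.toList_mul x, FreeMonoid.toList_of, List.prefix_concat_iff]
      refine or_iff_right fun h => hne ?_
      obtain ⟨rfl, rfl⟩ : v = x ∧ i = j := by simpa using h
      rfl

theorem toWord_mul_of [DecidableEq ι] (x : FreeGroup ι) (j : ι) :
    (x * .of j).toWord = x.toWord ++ [(j, true)] ∨
      x.toWord = (x * .of j).toWord ++ [(j, false)] := by
  have hx : FreeGroup.IsReduced x.toWord := FreeGroup.isReduced_toWord
  by_cases hlast : (j, false) ∈ x.toWord.getLast?
  · right
    obtain ⟨L, hL⟩ := List.getLast?_eq_some_iff.1 hlast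
    have hxL : x * .of j = FreeGroup.mk L := by
      rw [← FreeGroup.mk_toWord (x := x), hL, ← FreeGroup.mul_mk]
      exact inv_mul_cancel_right _ (FreeGroup.of j)
    rw [hL] at hx ⊢
    rw [hxL, FreeGroup.toWord_mk, (hx.infix (List.prefix_append L _).isInfix).reduce_eq]
  · left
    rw [FreeGroup.toWord_mul, FreeGroup.toWord_of]
    refine FreeGroup.IsReduced.reduce_eq (List.isChain_append.2 ⟨hx, List.isChain_singleton _, ?_⟩)
    simp only [List.head?_cons, Option.mem_some_iff, forall_eq']
    rintro ⟨i, b⟩ hb rfl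
    by_contra hb'
    exact hlast (Bool.eq_false_iff.2 hb' ▸ hb)

theorem isTree_mulCayley_freeGroup (ι : Type*) :
    (mulCayley (Set.range (FreeGroup.of (α := ι)))).IsTree where
  connected := ⟨preconnected_of_forall_reachable_mul fun x => by
    induction x using FreeGroup.induction_on with
    | C1 => simp
    | of i => exact fun v => reachable_mul_generator_mulCayley_range v i
    | inv_of i _ =>
      intro v
      simpa using (reachable_mul_generator_mulCayley_range (γ := .of) (v * (.of i)⁻¹) i).symm
    | mul x y hx hy => exact fun v => mul_assoc v x y ▸ (hx v).trans (hy (v * x))⟩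
  isAcyclic := by
    classical
    refine isAcyclic_mulCayley_range (fun v i => {x | v⁻¹ * x ∈ FreeGroup.startsWith (i, true)})
      (fun v i h => by simp [FreeGroup.startsWith] at h)
      (fun v i => by simp [FreeGroup.startsWith]) fun v i x j hne => ?_
    have hne' : v⁻¹ * x = 1 → j ≠ i := fun h hj => hne (by rw [inv_mul_eq_one.1 h, hj])
    simp only [Set.mem_ofPred_eq, ← mul_assoc, FreeGroup.startsWith]
    rw [← FreeGroup.toWord_eq_nil_iff] at hne'
    obtain h | h := toWord_mul_of (v⁻¹ * x) j <;> rw [h]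
    · cases hw : (v⁻¹ * x).toWord with
      | nil => simpa using hne' hw
      | cons a L => simp
    · cases (v⁻¹ * x * .of j).toWord <;> simp

end CayleyGraph

section Stationary

variable {M A : Type*} [MeasurableSpace A] [MeasurableSingletonClass A] {μ : Measure (M → A)}

theorem measure_inter_ne_zero_of_transitionMatrix_ne_zero [One M] {g : M} {a b : A}
    (h : transitionMatrix μ g a b ≠ 0) : μ ({x | x 1 = a} ∩ {x | x g = b}) ≠ 0 := by
  rw [transitionMatrix, Matrix.of_apply,
    ProbabilityTheory.cond_apply (measurableSet_setOf_apply_eq 1 a)] at h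
  exact right_ne_zero_of_mul h

variable [MulOneClass M]

theorem IsShiftStationary.measure_cylinderAt_pair [DecidableEq M] (hμ : IsShiftStationary μ)
    (m g : M) (x : M → A) :
    μ (cylinderAt {m, m * g} x) = μ ({y | y 1 = x m} ∩ {y | y g = x (m * g)}) := by
  rw [← (hμ m).measure_preimage ((measurableSet_setOf_apply_eq 1 _).inter
    (measurableSet_setOf_apply_eq g _)).nullMeasurableSet]
  congr 1
  ext y
  simp [cylinderAt, shiftMap]

theorem IsShiftStationary.exists_le_measure_cylinderAt [Finite A] [IsProbabilityMeasure μ]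
    [DecidableEq M] {ι : Type*} [Finite ι] [Nonempty ι] {γ : ι → M} (hμ : IsShiftStationary μ)
    (hpos : ∀ i a b, transitionMatrix μ (γ i) a b ≠ 0) :
    ∃ q : NNReal, q ≠ 0 ∧ (∀ v x, q ≤ μ (cylinderAt {v} x)) ∧
      ∀ v u, (SimpleGraph.mulCayley (Set.range γ)).Adj v u →
        ∀ x, q ≤ μ (cylinderAt {v, u} x) := by
  have : Nonempty A := (nonempty_of_isProbabilityMeasure μ).map (· 1)
  obtain ⟨⟨i₀, a₀, b₀⟩, hmin⟩ := Finite.exists_min fun p : ι × A × A =>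
    μ ({y | y 1 = p.2.1} ∩ {y | y (γ p.1) = p.2.2})
  have hq0 := measure_inter_ne_zero_of_transitionMatrix_ne_zero (hpos i₀ a₀ b₀)
  have hedge (i : ι) (v : M) (x : M → A) :
      μ ({y | y 1 = a₀} ∩ {y | y (γ i₀) = b₀}) ≤ μ (cylinderAt {v, v * γ i} x) := by
    rw [hμ.measure_cylinderAt_pair]
    exact hmin (i, x v, x (v * γ i))
  generalize μ ({y | y 1 = a₀} ∩ {y | y (γ i₀) = b₀}) = q at hq0 hedge
  lift q to NNReal using ((hedge i₀ 1 fun _ => a₀).trans_lt (measure_lt_top _ _)).ne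
  refine ⟨q, by exact_mod_cast hq0, fun v x => ?_, fun v u hvu x => ?_⟩
  · exact (hedge i₀ v x).trans <| measure_mono (cylinderAt_anti (by simp) x)
  · obtain ⟨i, rfl | rfl⟩ := (mulCayley_range_adj.1 hvu).2
    · exact hedge i v x
    · rw [Finset.pair_comm]
      exact hedge i u x

end Stationary

theorem IsMarkovRandomField.isHarmonicallyMixing_of_isAcyclic_mulCayley {M A ι : Type*}
    [MulOneClass M] [IsRightCancelMul M] [Group A] [Finite A] [TopologicalSpace A]
    [MeasurableSpace A] [MeasurableSingletonClass A] [Finite ι] [Nonempty ι] {γ : ι → M}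
    {μ : Measure (M → A)} [IsProbabilityMeasure μ]
    (hμ : IsMarkovRandomField (SimpleGraph.mulCayley (Set.range γ)) μ)
    (hγ : (SimpleGraph.mulCayley (Set.range γ)).IsAcyclic) (hst : IsShiftStationary μ)
    (hpos : ∀ i a b, transitionMatrix μ (γ i) a b ≠ 0) : IsHarmonicallyMixing μ := by
  classical
  choose f hf using exists_injective_neighborSet_mulCayley_range γ
  let : (SimpleGraph.mulCayley (Set.range γ)).LocallyFinite := fun v =>
    have := Finite.of_injective (f v) (hf v)
    Fintype.ofFinite _
  have hdegree (v : M) : (SimpleGraph.mulCayley (Set.range γ)).degree v ≤ Nat.card (ι ⊕ ι) := by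
    rw [← SimpleGraph.card_neighborSet_eq_degree, ← Nat.card_eq_fintype_card]
    exact Nat.card_le_card_of_injective (f v) (hf v)
  obtain ⟨q, hq0, hq, hqe⟩ := hst.exists_le_measure_cylinderAt hpos
  exact hμ.isHarmonicallyMixing_of_isAcyclic hγ hdegree hq0 hq hqe

theorem isHarmonicallyMixing_of_subsingleton {M A : Type*} [Subsingleton M] [Group A]
    [TopologicalSpace A] [MeasurableSpace A] (μ : Measure (M → A)) : IsHarmonicallyMixing μ :=
  fun _ _ => ⟨1, one_pos, fun _ hχ => absurd hχ <| not_lt.2 <| Set.encard_le_one_iff.2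
    fun a b _ _ => Subsingleton.elim a b⟩

theorem mainTheorem8_general {M A ι : Type*} [MulOneClass M] [IsRightCancelMul M] [Group A]
    [Finite A] [TopologicalSpace A] [MeasurableSpace A] [MeasurableSingletonClass A] [Finite ι]
    {γ : ι → M} (hγ : (SimpleGraph.mulCayley (Set.range γ)).IsTree) {μ : Measure (M → A)}
    [IsProbabilityMeasure μ] (hst : IsShiftStationary μ)
    (hμ : IsMarkovRandomField (SimpleGraph.mulCayley (Set.range γ)) μ)
    (hpos : ∀ i a b, transitionMatrix μ (γ i) a b ≠ 0) : IsHarmonicallyMixing μ := by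
  cases isEmpty_or_nonempty ι with
  | inl _ =>
    have hbot : SimpleGraph.mulCayley (Set.range γ) = ⊥ := by
      rw [Set.range_eq_empty, SimpleGraph.mulCayley_empty]
    have : Subsingleton M :=
      SimpleGraph.preconnected_bot_iff_subsingleton.1 (hbot ▸ hγ.connected.preconnected)
    exact isHarmonicallyMixing_of_subsingleton μ
  | inr _ => exact hμ.isHarmonicallyMixing_of_isAcyclic_mulCayley hγ.isAcyclic hst hpos

theorem mainTheorem8 {A : Type*} [Group A] [Finite A] [TopologicalSpace A] [DiscreteTopology A]
    [MeasurableSpace A] [BorelSpace A] {ι : Type*} [Finite ι] :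
    (∀ μ : Measure (FreeGroup ι → A), IsProbabilityMeasure μ → IsShiftStationary μ →
      IsMarkovRandomField (SimpleGraph.mulCayley (Set.range (FreeGroup.of (α := ι)))) μ →
      (∀ (i : ι) (a b : A), transitionMatrix μ (FreeGroup.of i) a b ≠ 0) →
      IsHarmonicallyMixing μ) ∧
    (∀ μ : Measure (FreeMonoid ι → A), IsProbabilityMeasure μ → IsShiftStationary μ →
      IsMarkovRandomField (SimpleGraph.mulCayley (Set.range (FreeMonoid.of (α := ι)))) μ →
      (∀ (i : ι) (a b : A), transitionMatrix μ (FreeMonoid.of i) a b ≠ 0) →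
      IsHarmonicallyMixing μ) :=
  ⟨fun _ _ => mainTheorem8_general (isTree_mulCayley_freeGroup ι),
    fun _ _ => mainTheorem8_general (isTree_mulCayley_freeMonoid ι)⟩
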